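/- A Desargues affine plane is an incidence structure of points and lines in which any two distinct points lie on exactly one line, through every point $X$ not on a line $\ell$ there is exactly one line disjoint from $\ell$, some three points are not collinear, and Desargues' axiom holds in both its parallel and its concurrent form. Two lines are parallel if they are equal or disjoint. Let $O\ne I$ be two points of a Desargues affine plane and let $\ell^{OI}$ be the line through them. For points $A,B\in\ell^{OI}$ define the sum and the product by the following constructions, in each of which $E$ is a point not on $\ell^{OI}$: * Sum: let $P_1$ be the intersection of the parallel to $\ell^{OI}$ through $E$ with the parallel to $OE$ through $A$; then $A+B$ is the intersection of $\ell^{OI}$ with the parallel to $BE$ through $P_1$. * Product: let $P_1$ be the intersection of the parallel to $IE$ through $A$ with the line $OE$; then $A\cdot B$ is the intersection of $\ell^{OI}$ with the parallel to $BE$ through $P_1$. These operations make $\ell^{OI}$ a skew field with zero $O$ and unit $I$. For $B\neq O$ let $B^{-1}$ be the inverse of $B$ (the point with $B\cdot B^{-1}=I$) and define the ratio of the points $A,B$ as $r(A:B)=B^{-1}\cdot A$. For $n\in\mathbb N$ the natural dilatation $\delta_n:\ell^{OI}\to\ell^{OI}$ is $\delta_n(A)=nA=A+A+\cdots+A$ ($n$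 summands, with $0A=O$). **Theorem.** Let $n\in\mathbb N$ be such that $nI\neq O$. Then for all points $A,B\in\ell^{OI}$ with $B\neq O$ we have $nB\neq O$ and $$r(\delta_n(A):\delta_n(B))=r(nA:nB)=r(A:B).$$ This holds for every choice of the auxiliary point used for the sums and every choice of the auxiliary point used for the products. -/

import Mathlib

set_option linter.unusedSectionVars false

namespace DesarguesPlane

/-- Two lines are parallel if they are equal or have no common point. -/
def Parallel {P L : Type*} [Membership P L] (l m : L) : Prop :=
  l = m ∨ ∀ X : P, ¬ (X ∈ l ∧ X ∈ m)

/-- Affine planes: incidence structures of points `P` and lines `L` such that two distinct points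
lie on exactly one line, Playfair's axiom holds, and some three points are not collinear. -/
class AffinePlane (P L : Type*) [Membership P L] : Prop where
  exists_unique_line : ∀ X Y : P, X ≠ Y → ∃! l : L, X ∈ l ∧ Y ∈ l
  playfair : ∀ (X : P) (l : L), X ∉ l → ∃! m : L, X ∈ m ∧ ∀ Y : P, ¬ (Y ∈ l ∧ Y ∈ m)
  exists_noncollinear : ∃ X Y Z : P, X ≠ Y ∧ X ≠ Z ∧ Y ≠ Z ∧ ∀ l : L, ¬ (X ∈ l ∧ Y ∈ l ∧ Z ∈ l)

/-- Desargues affine planes: affine planes with both (parallel and concurrent) forms of Desargues'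
axiom. Here `a`, `b`, `c` are the lines `AA'`, `BB'`, `CC'`. In the concurrent form the six points
differ from the centre. -/
class DesarguesAffinePlane (P L : Type*) [Membership P L] : Prop extends AffinePlane P L where
  desargues : ∀ (A B C A' B' C' : P) (a b c : L),
    a ≠ b → b ≠ c → a ≠ c →
    A ∈ a → A' ∈ a → B ∈ b → B' ∈ b → C ∈ c → C' ∈ c →
    ((Parallel a b ∧ Parallel b c) ∨
      (∃ S : P, S ∈ a ∧ S ∈ b ∧ S ∈ c ∧
        A ≠ S ∧ B ≠ S ∧ C ≠ S ∧ A' ≠ S ∧ B' ≠ S ∧ C' ≠ S)) →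
    ∀ lAB lAB' lBC lBC' lAC lAC' : L,
      A ∈ lAB → B ∈ lAB → A' ∈ lAB' → B' ∈ lAB' →
      B ∈ lBC → C ∈ lBC → B' ∈ lBC' → C' ∈ lBC' →
      A ∈ lAC → C ∈ lAC → A' ∈ lAC' → C' ∈ lAC' →
      Parallel lAB lAB' → Parallel lBC lBC' → Parallel lAC lAC'

section Constructions

variable {P L : Type*} [Membership P L] [AffinePlane P L]

theorem Parallel.symm {P L : Type*} [Membership P L] {l m : L} (h : Parallel l m) :
    Parallel m l := by
  rcases h with h | h
  · exact Or.inl h.symm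
  · exact Or.inr fun X hX => h X ⟨hX.2, hX.1⟩

theorem Parallel.eq_of_mem {P L : Type*} [Membership P L] {l m : L} {X : P} (h : Parallel l m)
    (hl : X ∈ l) (hm : X ∈ m) : l = m := by
  rcases h with h | h
  · exact h
  · exact absurd ⟨hl, hm⟩ (h X)

theorem eq_of_mem_mem {l m : L} {X Y : P} (h : X ≠ Y) (hXl : X ∈ l) (hYl : Y ∈ l)
    (hXm : X ∈ m) (hYm : Y ∈ m) : l = m :=
  (AffinePlane.exists_unique_line X Y h).unique ⟨hXl, hYl⟩ ⟨hXm, hYm⟩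

theorem Parallel.trans {l m k : L} (h₁ : Parallel l m) (h₂ : Parallel m k) : Parallel l k := by
  rcases h₁ with rfl | h₁
  · exact h₂
  rcases h₂ with rfl | h₂
  · exact Or.inr h₁
  by_cases h : ∃ X : P, X ∈ l ∧ X ∈ k
  · obtain ⟨X, hl, hk⟩ := h
    have hX : X ∉ m := fun hm => h₁ X ⟨hl, hm⟩
    exact Or.inl ((AffinePlane.playfair X m hX).unique
      ⟨hl, fun Y hY => h₁ Y ⟨hY.2, hY.1⟩⟩ ⟨hk, h₂⟩)
  · exact Or.inr fun X hX => h ⟨X, hX⟩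

theorem exists_line (X Y : P) (h : X ≠ Y) : ∃ l : L, X ∈ l ∧ Y ∈ l :=
  (AffinePlane.exists_unique_line X Y h).exists

theorem exists_parallel (X : P) (l : L) : ∃ m : L, X ∈ m ∧ Parallel m l := by
  by_cases hX : X ∈ l
  · exact ⟨l, hX, Or.inl rfl⟩
  · obtain ⟨m, hm, -⟩ := AffinePlane.playfair X l hX
    exact ⟨m, hm.1, Or.inr fun Y hY => hm.2 Y ⟨hY.2, hY.1⟩⟩

theorem exists_meet {l m : L} (h : ¬ Parallel l m) : ∃ X : P, X ∈ l ∧ X ∈ m := by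
  by_contra hne
  exact h (Or.inr fun X hX => hne ⟨X, hX⟩)

/-- The line through two distinct points. -/
noncomputable def join (L : Type*) {P : Type*} [Membership P L] [AffinePlane P L]
    (X Y : P) (h : X ≠ Y) : L :=
  (exists_line (L := L) X Y h).choose

/-- The line through `X` parallel to `l`. -/
noncomputable def par (X : P) (l : L) : L := (exists_parallel X l).choose

/-- The common point of two lines that are not parallel. -/
noncomputable def meet (l m : L) (h : ¬ Parallel l m) : P := (exists_meet h).choose

theorem left_mem_join {X Y : P} (h : X ≠ Y) : X ∈ join L X Y h :=
  (exists_line (L := L) X Y h).choose_spec.1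

theorem right_mem_join {X Y : P} (h : X ≠ Y) : Y ∈ join L X Y h :=
  (exists_line (L := L) X Y h).choose_spec.2

theorem mem_par (X : P) (l : L) : X ∈ par X l := (exists_parallel X l).choose_spec.1

theorem par_parallel (X : P) (l : L) : Parallel (par X l) l := (exists_parallel X l).choose_spec.2

theorem meet_mem_left {l m : L} (h : ¬ Parallel l m) : meet l m h ∈ l :=
  (exists_meet h).choose_spec.1

theorem meet_mem_right {l m : L} (h : ¬ Parallel l m) : meet l m h ∈ m :=
  (exists_meet h).choose_spec.2

theorem not_parallel_par {X Y : P} {l m : L} (h : ¬ Parallel l m) :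
    ¬ Parallel (par X l) (par Y m) := fun hp =>
  h (((par_parallel X l).symm.trans hp).trans (par_parallel Y m))

theorem not_parallel_par_left {X : P} {l m : L} (h : ¬ Parallel l m) :
    ¬ Parallel (par X l) m := fun hp => h ((par_parallel X l).symm.trans hp)

/-- A line meeting `l` that contains a point off `l` is not parallel to `l`. -/
theorem not_parallel_of_mem {X Y : P} {l m : L} (hX : X ∈ l) (hXm : X ∈ m) (hY : Y ∉ l)
    (hYm : Y ∈ m) : ¬ Parallel m l := fun h => hY (h.eq_of_mem hXm hX ▸ hYm)

theorem ne_of_mem_of_not_mem {X Y : P} {l : L} (hX : X ∈ l) (hY : Y ∉ l) : X ≠ Y := by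
  rintro rfl
  exact hY hX

theorem meet_unique {X : P} {l m : L} (h : ¬ Parallel l m) (hl : X ∈ l) (hm : X ∈ m) :
    X = meet l m h := by
  by_contra hne
  exact h (Or.inl (eq_of_mem_mem hne hl (meet_mem_left h) hm (meet_mem_right h)))

end Constructions

/-- Two distinct points `O`, `I`: the data that turn the line `OI` into a skew field with zero `O`
and unit `I`. -/
structure Frame (P L : Type*) [Membership P L] [AffinePlane P L] where
  O : P
  I : P
  ne : O ≠ I

namespace Frame

variable {P L : Type*} [Membership P L] [AffinePlane P L] (f : Frame P L)

/-- The line `OI`. -/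
noncomputable def line : L := join L f.O f.I f.ne

/-- Points of the line `OI`. -/
def Pt : Type _ := {X : P // X ∈ f.line}

/-- Auxiliary points: points not on the line `OI`. -/
def Aux : Type _ := {X : P // X ∉ f.line}

/-- The point `O` of the line `OI`. -/
noncomputable def zero : f.Pt := ⟨f.O, left_mem_join f.ne⟩

/-- The point `I` of the line `OI`. -/
noncomputable def one : f.Pt := ⟨f.I, right_mem_join f.ne⟩

variable {f}

theorem pt_ne_aux (A : f.Pt) (E : f.Aux) : A.1 ≠ E.1 := ne_of_mem_of_not_mem A.2 E.2

/-- The line joining a point of `OI` to an auxiliary point. -/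
noncomputable def ray (A : f.Pt) (E : f.Aux) : L := join L A.1 E.1 (pt_ne_aux A E)

theorem ray_not_parallel (A : f.Pt) (E : f.Aux) : ¬ Parallel (ray A E) f.line :=
  not_parallel_of_mem A.2 (left_mem_join _) E.2 (right_mem_join _)

theorem not_parallel_ray (A : f.Pt) (E : f.Aux) : ¬ Parallel f.line (ray A E) :=
  fun h => ray_not_parallel A E h.symm

theorem ray_not_parallel_ray {A B : f.Pt} (h : A ≠ B) (E : f.Aux) :
    ¬ Parallel (ray A E) (ray B E) := by
  intro hp
  have he : ray A E = ray B E := hp.eq_of_mem (right_mem_join _) (right_mem_join _)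
  have hB : B.1 ∈ ray A E := he ▸ left_mem_join (pt_ne_aux B E)
  have hl : ray A E = f.line :=
    eq_of_mem_mem (fun hAB => h (Subtype.ext hAB)) (left_mem_join _) hB A.2 B.2
  exact ray_not_parallel A E (Or.inl hl)

theorem one_ne_zero : f.one ≠ f.zero := fun h => f.ne (congrArg Subtype.val h).symm

/-- The sum `A + B`, constructed with the auxiliary point `E`: the parallel to `OI` through `E` and
the parallel to `OE` through `A` meet in `P₁`, and the parallel to `BE` through `P₁` meets `OI` in
`A + B`. -/
noncomputable def add (E : f.Aux) (A B : f.Pt) : f.Pt :=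
  let P₁ : P := meet (par E.1 f.line) (par A.1 (ray f.zero E))
    (not_parallel_par (not_parallel_ray f.zero E))
  ⟨meet (par P₁ (ray B E)) f.line (not_parallel_par_left (ray_not_parallel B E)),
    meet_mem_right _⟩

/-- The point `P₁` in which the parallel to `IE` through `A` meets `OE`. -/
noncomputable def mulAux (E : f.Aux) (A : f.Pt) : P :=
  meet (par A.1 (ray f.one E)) (ray f.zero E)
    (not_parallel_par_left (ray_not_parallel_ray one_ne_zero E))

/-- The product `A · B`, constructed with the auxiliary point `E`: the parallel to `IE` through `A`
meets `OE` in `P₁`, and the parallel to `BE` through `P₁` meets `OI` in `A · B`. -/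
noncomputable def mul (E : f.Aux) (A B : f.Pt) : f.Pt :=
  ⟨meet (par (mulAux E A) (ray B E)) f.line (not_parallel_par_left (ray_not_parallel B E)),
    meet_mem_right _⟩

/-- The natural multiple `n A = A + A + ⋯ + A` (`n` summands), with `0 A = O`. This is the natural
dilatation `δ_n`. -/
noncomputable def natMul (E : f.Aux) : ℕ → f.Pt → f.Pt
  | 0, _ => f.zero
  | 1, A => A
  | n + 2, A => add E (natMul E (n + 1) A) A

/-- Every point `B ≠ O` has exactly one point `X` with `B · X = I`. -/
theorem exists_unique_inv (E : f.Aux) (B : f.Pt) (hB : B ≠ f.zero) :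
    ∃! X : f.Pt, mul E B X = f.one := by
  have hP₁ : mulAux E B ∉ f.line := by
    intro h
    have h₁ : mulAux E B ∈ ray f.zero E := meet_mem_right _
    have h₂ : mulAux E B ∈ par B.1 (ray f.one E) := meet_mem_left _
    have h₃ : mulAux E B = f.zero.1 :=
      (meet_unique (ray_not_parallel f.zero E) h₁ h).trans
        (meet_unique (ray_not_parallel f.zero E) (left_mem_join _) f.zero.2).symm
    rw [h₃] at h₂
    have h₄ : par B.1 (ray f.one E) = f.line :=
      eq_of_mem_mem (fun hAB => hB (Subtype.ext hAB)) (mem_par _ _) h₂ B.2 f.zero.2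
    exact not_parallel_par_left (ray_not_parallel f.one E) (Or.inl h₄)
  have hI : f.one.1 ≠ mulAux E B := ne_of_mem_of_not_mem f.one.2 hP₁
  obtain ⟨m, hIm, hPm⟩ := exists_line (L := L) f.one.1 (mulAux E B) hI
  have hm : ¬ Parallel m f.line := not_parallel_of_mem f.one.2 hIm hP₁ hPm
  have hk : ¬ Parallel (par E.1 m) f.line := not_parallel_par_left hm
  refine ⟨⟨meet (par E.1 m) f.line hk, meet_mem_right hk⟩, ?_, ?_⟩
  · set X : f.Pt := ⟨meet (par E.1 m) f.line hk, meet_mem_right hk⟩ with hX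
    have h₁ : ray X E = par E.1 m :=
      eq_of_mem_mem (pt_ne_aux X E) (left_mem_join _) (right_mem_join _)
        (meet_mem_left hk) (mem_par _ _)
    have h₂ : par (mulAux E B) (ray X E) = m :=
      ((par_parallel _ _).trans (h₁ ▸ par_parallel E.1 m)).eq_of_mem (mem_par _ _) hPm
    exact Subtype.ext (meet_unique (not_parallel_par_left (ray_not_parallel X E))
      (h₂.symm ▸ hIm) f.one.2).symm
  · intro Y hY
    have h₁ : f.one.1 ∈ par (mulAux E B) (ray Y E) := by
      rw [← hY]
      exact meet_mem_left (not_parallel_par_left (ray_not_parallel Y E))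
    have h₂ : par (mulAux E B) (ray Y E) = m := eq_of_mem_mem hI h₁ (mem_par _ _) hIm hPm
    have h₃ : ray Y E = par E.1 m :=
      ((par_parallel (mulAux E B) (ray Y E)).symm.trans
        (h₂ ▸ (par_parallel E.1 m).symm)).eq_of_mem (right_mem_join _) (mem_par _ _)
    exact Subtype.ext (meet_unique hk (h₃ ▸ left_mem_join (pt_ne_aux Y E)) Y.2)

/-- The inverse of a point `B ≠ O`: the point `X` with `B · X = I`. -/
noncomputable def inv (E : f.Aux) (B : f.Pt) (hB : B ≠ f.zero) : f.Pt :=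
  (exists_unique_inv E B hB).choose

/-- The ratio `r(A : B) = B⁻¹ A` of two points `A` and `B ≠ O` of the line `OI`. -/
noncomputable def ratio (E : f.Aux) (A B : f.Pt) (hB : B ≠ f.zero) : f.Pt :=
  mul E (inv E B hB) A

end Frame

end DesarguesPlane

/-!
The points of the line `OI` are studied through two kinds of additive maps. Left multiplication
`A ↦ X · A` is the restriction to `OI` of a homothety with centre `O`, and right multiplication
`A ↦ A · X` is a composition of two parallel projections, from `OI` to `OE` and back. The concurrent
form of Desargues' axiom makes the former additive (`Frame.mul_add`), the parallel form the latter
(`Frame.add_mul`). Both arguments change the auxiliary point of the sum, so they rest on the fact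
that the sum does not depend on it (`Frame.add_eq_add`), again by the parallel form.

Hence `X · (nA) = n(X · A)` and `(nA) · X = n(A · X)`, and associativity of the product is not
needed. Since `nB = (nI) · B` and the product has no zero divisors, `nB ≠ O`. If `X` is the inverse
of `nB`, then `B · (nX) = n(B · X) = (nB) · X = I`, so `nX` is the inverse of `B`, and
`X · (nA) = n(X · A) = (nX) · A`, which is the equality of the two ratios.
-/

namespace DesarguesPlane

/-! ### Parallels and the two Desargues configurations -/

section Lines

variable {P L : Type*} [Membership P L] [AffinePlane P L]

theorem mem_par_of_mem {X Y : P} {l m : L} (h : Parallel m l) (hX : X ∈ m) (hY : Y ∈ m) :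
    Y ∈ par X l :=
  ((par_parallel X l).trans h.symm).eq_of_mem (mem_par X l) hX ▸ hY

theorem mem_par_comm {X Y : P} {l : L} (h : Y ∈ par X l) : X ∈ par Y l :=
  mem_par_of_mem (par_parallel X l) h (mem_par X l)

theorem mem_par_trans {X Y Z : P} {l : L} (h₁ : Y ∈ par X l) (h₂ : Z ∈ par Y l) :
    Z ∈ par X l :=
  mem_par_of_mem (par_parallel Y l) (mem_par_comm h₁) h₂

theorem mem_par_congr {X Y : P} {l m : L} (h : Y ∈ par X l) (hlm : Parallel l m) :
    Y ∈ par X m :=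
  mem_par_of_mem ((par_parallel X l).trans hlm) (mem_par X l) h

theorem parallel_of_mem_par {X Y : P} {l m : L} (h : X ≠ Y) (hl : Y ∈ par X l)
    (hm : Y ∈ par X m) : Parallel l m :=
  (par_parallel X l).symm.trans
    (eq_of_mem_mem h (mem_par X l) hl (mem_par X m) hm ▸ par_parallel X m)

theorem par_eq_self {X : P} {l : L} (h : X ∈ l) : par X l = l :=
  (par_parallel X l).eq_of_mem (mem_par X l) h

theorem eq_of_mem_of_not_parallel {X Y : P} {l m : L} (h : ¬ Parallel l m) (hXl : X ∈ l)
    (hXm : X ∈ m) (hYl : Y ∈ l) (hYm : Y ∈ m) : X = Y :=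
  (meet_unique h hXl hXm).trans (meet_unique h hYl hYm).symm

end Lines

section Desargues

variable {P L : Type*} [Membership P L] [DesarguesAffinePlane P L]

/-- The parallel form of Desargues' axiom, with the directions of the sides given by the lines
`d`, `e`, `g`. -/
theorem desargues_parallel {A B C A' B' C' : P} {a b c d e g : L}
    (hab : a ≠ b) (hbc : b ≠ c) (hac : a ≠ c) (pab : Parallel a b) (pbc : Parallel b c)
    (hA : A ∈ a) (hA' : A' ∈ a) (hB : B ∈ b) (hB' : B' ∈ b) (hC : C ∈ c) (hC' : C' ∈ c)
    (h₁ : B ∈ par A d) (h₁' : B' ∈ par A' d) (h₂ : C ∈ par B e) (h₂' : C' ∈ par B' e)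
    (h₃ : C ∈ par A g) : C' ∈ par A' g := by
  have hne : A' ≠ C' := fun h => hac ((pab.trans pbc).eq_of_mem hA' (h ▸ hC'))
  have h := DesarguesAffinePlane.desargues A B C A' B' C' a b c hab hbc hac hA hA' hB hB' hC hC'
    (Or.inl ⟨pab, pbc⟩) _ _ _ _ _ _ (mem_par A d) h₁ (mem_par A' d) h₁' (mem_par B e) h₂
    (mem_par B' e) h₂' (mem_par A g) h₃ (left_mem_join hne) (right_mem_join hne)
    ((par_parallel A d).trans (par_parallel A' d).symm)
    ((par_parallel B e).trans (par_parallel B' e).symm)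
  exact mem_par_of_mem (h.symm.trans (par_parallel A g)) (left_mem_join hne) (right_mem_join hne)

/-- The concurrent form of Desargues' axiom, with centre `S` and with the directions of the sides
given by the lines `d`, `e`, `g`. -/
theorem desargues_concurrent {S A B C A' B' C' : P} {a b c d e g : L}
    (hab : a ≠ b) (hbc : b ≠ c) (hac : a ≠ c) (hSa : S ∈ a) (hSb : S ∈ b) (hSc : S ∈ c)
    (nA : A ≠ S) (nB : B ≠ S) (nC : C ≠ S) (nA' : A' ≠ S) (nB' : B' ≠ S) (nC' : C' ≠ S)
    (hA : A ∈ a) (hA' : A' ∈ a) (hB : B ∈ b) (hB' : B' ∈ b) (hC : C ∈ c) (hC' : C' ∈ c)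
    (h₁ : B ∈ par A d) (h₁' : B' ∈ par A' d) (h₂ : C ∈ par B e) (h₂' : C' ∈ par B' e)
    (h₃ : C ∈ par A g) : C' ∈ par A' g := by
  have hne : A' ≠ C' := fun h => hac (eq_of_mem_mem nA' hA' hSa (h ▸ hC') hSc)
  have h := DesarguesAffinePlane.desargues A B C A' B' C' a b c hab hbc hac hA hA' hB hB' hC hC'
    (Or.inr ⟨S, hSa, hSb, hSc, nA, nB, nC, nA', nB', nC'⟩) _ _ _ _ _ _
    (mem_par A d) h₁ (mem_par A' d) h₁' (mem_par B e) h₂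
    (mem_par B' e) h₂' (mem_par A g) h₃ (left_mem_join hne) (right_mem_join hne)
    ((par_parallel A d).trans (par_parallel A' d).symm)
    ((par_parallel B e).trans (par_parallel B' e).symm)
  exact mem_par_of_mem (h.symm.trans (par_parallel A g)) (left_mem_join hne) (right_mem_join hne)

end Desargues

namespace Frame

section Affine

variable {P L : Type*} [Membership P L] [AffinePlane P L] {f : Frame P L}

/-! ### Characterizations of the sum and the product -/

theorem mem_ray_left (A : f.Pt) (E : f.Aux) : A.1 ∈ ray A E := left_mem_join _

theorem mem_ray_right (A : f.Pt) (E : f.Aux) : E.1 ∈ ray A E := right_mem_join _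

theorem eq_of_ray_parallel {A B : f.Pt} {E : f.Aux} (h : Parallel (ray A E) (ray B E)) : A = B :=
  by_contra fun hne => ray_not_parallel_ray hne E h

theorem mem_par_ray (A : f.Pt) (E : f.Aux) : E.1 ∈ par A.1 (ray A E) :=
  mem_par_of_mem (Or.inl rfl) (mem_ray_left A E) (mem_ray_right A E)

theorem ray_parallel {A : f.Pt} {E : f.Aux} {m : L} (h : A.1 ∈ par E.1 m) :
    Parallel (ray A E) m :=
  parallel_of_mem_par (pt_ne_aux A E) (mem_par_ray A E) (mem_par_comm h)

theorem not_mem_line_of_mem_par {X Y : P} (hY : Y ∉ f.line) (h : X ∈ par Y f.line) :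
    X ∉ f.line := fun hX =>
  hY (par_eq_self hX ▸ mem_par_comm h)

theorem par_line_ne (E : f.Aux) : par E.1 f.line ≠ f.line := by
  intro he
  have h := mem_par E.1 f.line
  rw [he] at h
  exact E.2 h

theorem add_spec (E : f.Aux) (A B : f.Pt) :
    ∃ Q : P, Q ∈ par E.1 f.line ∧ Q ∈ par A.1 (ray f.zero E) ∧
      (add E A B).1 ∈ par Q (ray B E) :=
  ⟨_, meet_mem_left (not_parallel_par (not_parallel_ray f.zero E)), meet_mem_right _,
    meet_mem_left (not_parallel_par_left (ray_not_parallel B E))⟩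

theorem add_eq {E : f.Aux} {A B S : f.Pt} {Q : P} (h₁ : Q ∈ par E.1 f.line)
    (h₂ : Q ∈ par A.1 (ray f.zero E)) (h₃ : S.1 ∈ par Q (ray B E)) : add E A B = S := by
  obtain ⟨Q', h₁', h₂', h₃'⟩ := add_spec E A B
  obtain rfl : Q = Q' := eq_of_mem_of_not_parallel
    (not_parallel_par (not_parallel_ray f.zero E)) h₁ h₂ h₁' h₂'
  exact Subtype.ext (eq_of_mem_of_not_parallel
    (not_parallel_par_left (ray_not_parallel B E)) h₃' (add E A B).2 h₃ S.2)

theorem zero_add (E : f.Aux) (B : f.Pt) : add E f.zero B = B :=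
  add_eq (mem_par _ _) (mem_par_ray f.zero E) (mem_par_comm (mem_par_ray B E))

theorem add_zero (E : f.Aux) (A : f.Pt) : add E A f.zero = A := by
  obtain ⟨Q, h₁, h₂, -⟩ := add_spec E A f.zero
  exact add_eq h₁ h₂ (mem_par_comm h₂)

theorem eq_zero_of_add_eq_left {E : f.Aux} {A B : f.Pt} (h : add E A B = A) : B = f.zero := by
  obtain ⟨Q, h₁, h₂, h₃⟩ := add_spec E A B
  rw [h] at h₃
  have hQ : Q ∉ f.line := not_mem_line_of_mem_par E.2 h₁
  exact eq_of_ray_parallel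
    (parallel_of_mem_par (ne_of_mem_of_not_mem A.2 hQ) (mem_par_comm h₃) h₂)

theorem mulAux_mem_ray (E : f.Aux) (A : f.Pt) : mulAux E A ∈ ray f.zero E := meet_mem_right _

theorem mulAux_mem_par (E : f.Aux) (A : f.Pt) : mulAux E A ∈ par A.1 (ray f.one E) :=
  meet_mem_left (not_parallel_par_left (ray_not_parallel_ray one_ne_zero E))

theorem mul_mem_par (E : f.Aux) (A B : f.Pt) :
    (mul E A B).1 ∈ par (mulAux E A) (ray B E) :=
  meet_mem_left (not_parallel_par_left (ray_not_parallel B E))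

theorem mulAux_eq {E : f.Aux} {A : f.Pt} {Q : P} (h₁ : Q ∈ par A.1 (ray f.one E))
    (h₂ : Q ∈ ray f.zero E) : mulAux E A = Q :=
  (meet_unique (not_parallel_par_left (ray_not_parallel_ray one_ne_zero E)) h₁ h₂).symm

theorem mul_eq {E : f.Aux} {A B S : f.Pt} (h : S.1 ∈ par (mulAux E A) (ray B E)) :
    mul E A B = S :=
  Subtype.ext (eq_of_mem_of_not_parallel (not_parallel_par_left (ray_not_parallel B E))
    (mul_mem_par E A B) (mul E A B).2 h S.2)

theorem mulAux_zero (E : f.Aux) : mulAux E f.zero = f.zero.1 :=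
  mulAux_eq (mem_par _ _) (mem_ray_left _ _)

theorem mulAux_one (E : f.Aux) : mulAux E f.one = E.1 :=
  mulAux_eq (mem_par_ray f.one E) (mem_ray_right _ _)

theorem zero_mul (E : f.Aux) (A : f.Pt) : mul E f.zero A = f.zero :=
  mul_eq (by rw [mulAux_zero]; exact mem_par _ _)

theorem mul_zero (E : f.Aux) (A : f.Pt) : mul E A f.zero = f.zero :=
  mul_eq (mem_par_of_mem (Or.inl rfl) (mulAux_mem_ray E A) (mem_ray_left _ _))

theorem one_mul (E : f.Aux) (A : f.Pt) : mul E f.one A = A :=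
  mul_eq (by rw [mulAux_one]; exact mem_par_comm (mem_par_ray A E))

theorem mul_one (E : f.Aux) (A : f.Pt) : mul E A f.one = A :=
  mul_eq (mem_par_comm (mulAux_mem_par E A))

theorem mulAux_notMem {E : f.Aux} {A : f.Pt} (hA : A ≠ f.zero) : mulAux E A ∉ f.line := by
  intro h
  have h₀ : mulAux E A = f.zero.1 := eq_of_mem_of_not_parallel (ray_not_parallel f.zero E)
    (mulAux_mem_ray E A) h (mem_ray_left _ _) f.zero.2
  have h₁ : f.zero.1 ∈ par A.1 (ray f.one E) := h₀ ▸ mulAux_mem_par E A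
  exact hA (Subtype.ext (eq_of_mem_of_not_parallel
    (not_parallel_par_left (ray_not_parallel f.one E)) (mem_par _ _) A.2 h₁ f.zero.2))

theorem mul_ne_zero {E : f.Aux} {A B : f.Pt} (hA : A ≠ f.zero) (hB : B ≠ f.zero) :
    mul E A B ≠ f.zero := by
  intro h
  have h₁ := mul_mem_par E A B
  rw [h] at h₁
  exact hB (eq_of_ray_parallel (parallel_of_mem_par
    (ne_of_mem_of_not_mem f.zero.2 (mulAux_notMem hA)) (mem_par_comm h₁)
    (mem_par_of_mem (Or.inl rfl) (mem_ray_left _ _) (mulAux_mem_ray E A))))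

/-- For `A ≠ O`, the point of `OE` that represents `A` in products is itself an auxiliary point. -/
noncomputable def mulAuxPt (E : f.Aux) (A : f.Pt) (hA : A ≠ f.zero) : f.Aux :=
  ⟨mulAux E A, mulAux_notMem hA⟩

theorem ray_zero_mulAuxPt (E : f.Aux) (A : f.Pt) (hA : A ≠ f.zero) :
    ray f.zero (mulAuxPt E A hA) = ray f.zero E :=
  eq_of_mem_mem (pt_ne_aux f.zero (mulAuxPt E A hA)) (mem_ray_left _ _) (mem_ray_right _ _)
    (mem_ray_left _ _) (mulAux_mem_ray E A)

end Affine

section Desargues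

variable {P L : Type*} [Membership P L] [DesarguesAffinePlane P L] {f : Frame P L}

/-! ### The sum does not depend on the auxiliary point -/

theorem add_eq_add_of_notMem_par {E E' : f.Aux} (h : E'.1 ∉ par E.1 f.line) (A B : f.Pt) :
    add E A B = add E' A B := by
  obtain ⟨Q, h₁, h₂, h₃⟩ := add_spec E A B
  obtain ⟨Q', h₁', h₂', -⟩ := add_spec E' A B
  have hE : par E.1 f.line ≠ f.line := par_line_ne E
  have hE' : par E'.1 f.line ≠ f.line := par_line_ne E'
  have hEE' : par E.1 f.line ≠ par E'.1 f.line := fun he => h (he ▸ mem_par E'.1 f.line)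
  have hne : E.1 ≠ E'.1 := ne_of_mem_of_not_mem (mem_par E.1 f.line) h
  have pE := par_parallel E.1 f.line
  have pE' := par_parallel E'.1 f.line
  -- The translation taking `O` to `A` takes `E` to `Q` and `E'` to `Q'`.
  have hQ : Q' ∈ par Q (join L E.1 E'.1 hne) :=
    desargues_parallel hE hE'.symm hEE' pE pE'.symm (mem_par _ _) h₁ f.zero.2 A.2 (mem_par _ _) h₁'
      (mem_par_comm (mem_par_ray f.zero E)) (mem_par_comm h₂) (mem_par_ray f.zero E') h₂'
      (mem_par_of_mem (Or.inl rfl) (left_mem_join hne) (right_mem_join hne))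
  have hS : Q' ∈ par (add E A B).1 (ray B E') :=
    desargues_parallel hE.symm hEE' hE'.symm pE.symm (pE.trans pE'.symm) B.2 (add E A B).2
      (mem_par _ _) h₁ (mem_par _ _) h₁' (mem_par_ray B E) (mem_par_comm h₃)
      (mem_par_of_mem (Or.inl rfl) (left_mem_join hne) (right_mem_join hne)) hQ (mem_par_ray B E')
  exact (add_eq h₁' h₂' (mem_par_comm hS)).symm

/-- If the line `OI` and one parallel to it cover the plane, then `OI` has only two points. -/
theorem eq_of_cover {E E' : f.Aux} (hne : E.1 ≠ E'.1) (hE' : E'.1 ∈ par E.1 f.line)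
    (hcov : ∀ X : P, X ∉ f.line → X ∈ par E.1 f.line) {A B : f.Pt} (hA : A ≠ f.zero)
    (hB : B ≠ f.zero) : A = B := by
  have key : ∀ C : f.Pt, C ≠ f.zero → Parallel (ray C E') (ray f.zero E) := by
    intro C hC
    right
    rintro X ⟨h₁, h₂⟩
    by_cases hX : X ∈ f.line
    · exact hC (Subtype.ext ((eq_of_mem_of_not_parallel (ray_not_parallel C E')
        (mem_ray_left _ _) C.2 h₁ hX).trans (eq_of_mem_of_not_parallel
          (ray_not_parallel f.zero E) h₂ hX (mem_ray_left _ _) f.zero.2)))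
    · have hp : ∀ {C : f.Pt} {G : f.Aux}, ¬ Parallel (ray C G) (par E.1 f.line) :=
        fun hp => ray_not_parallel _ _ (hp.trans (par_parallel _ _))
      exact hne ((eq_of_mem_of_not_parallel hp (mem_ray_right _ _) (mem_par _ _) h₂
        (hcov X hX)).trans (eq_of_mem_of_not_parallel hp h₁ (hcov X hX) (mem_ray_right _ _) hE'))
  exact eq_of_ray_parallel ((key A hA).trans (key B hB).symm)

theorem add_eq_add (E E' : f.Aux) (A B : f.Pt) : add E A B = add E' A B := by
  by_cases h : E'.1 ∈ par E.1 f.line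
  swap
  · exact add_eq_add_of_notMem_par h A B
  by_cases hG : ∃ G : P, G ∉ f.line ∧ G ∉ par E.1 f.line
  · obtain ⟨G, hG, hGE⟩ := hG
    exact (add_eq_add_of_notMem_par (E' := ⟨G, hG⟩) hGE A B).trans
      (add_eq_add_of_notMem_par (fun hE' => hGE (mem_par_trans h hE')) A B).symm
  -- Otherwise the plane is the one of order two, where `OI` has only the points `O` and `A`.
  push Not at hG
  by_cases hne : E.1 = E'.1
  · rw [show E = E' from Subtype.ext hne]
  by_cases hA : A = f.zero
  · rw [hA, zero_add, zero_add]
  by_cases hB : B = f.zero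
  · rw [hB, add_zero, add_zero]
  have key : ∀ G : f.Aux, add G A B = f.zero := fun G => by_contra fun hs =>
    hB (eq_zero_of_add_eq_left (eq_of_cover hne h hG hs hA))
  rw [key, key]

/-! ### Distributivity -/

theorem mul_add (E F : f.Aux) (X A B : f.Pt) :
    mul F X (add E A B) = add E (mul F X A) (mul F X B) := by
  by_cases hX : X = f.zero
  · simp only [hX, zero_mul, zero_add]
  by_cases hA : A = f.zero
  · simp only [hA, mul_zero, zero_add]
  rw [add_eq_add E F, add_eq_add E (mulAuxPt F X hX)]
  set S := add F A B with hS
  obtain ⟨Q, h₁, h₂, h₃⟩ := add_spec F A B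
  rw [← hS] at h₃
  set R := mulAuxPt F X hX with hR
  have hRF : R.1 ∈ ray f.zero F := mulAux_mem_ray F X
  have hmul : ∀ C : f.Pt, (mul F X C).1 ∈ par R.1 (ray C F) := mul_mem_par F X
  have hQl : Q ∉ f.line := not_mem_line_of_mem_par F.2 h₁
  have hOQ : f.zero.1 ≠ Q := ne_of_mem_of_not_mem f.zero.2 hQl
  have hc : ¬ Parallel (join L f.zero.1 Q hOQ) (par R.1 f.line) := fun hp =>
    not_parallel_of_mem f.zero.2 (left_mem_join hOQ) hQl (right_mem_join hOQ)
      (hp.trans (par_parallel _ _))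
  -- `Q'` is the image of `Q` under the homothety with centre `O` that takes `F` to `R`.
  obtain ⟨Q', hQc, hQR⟩ := exists_meet hc
  have hQ'l : Q' ∉ f.line := not_mem_line_of_mem_par R.2 hQR
  have hcl : join L f.zero.1 Q hOQ ≠ f.line := fun he => hQl (he ▸ right_mem_join hOQ)
  have hrl : ray f.zero F ≠ f.line := fun he => ray_not_parallel f.zero F (Or.inl he)
  have hcr : join L f.zero.1 Q hOQ ≠ ray f.zero F := by
    intro he
    have hQr : Q ∈ ray f.zero F := he ▸ right_mem_join hOQ
    have hAr : A.1 ∈ ray f.zero F := par_eq_self hQr ▸ mem_par_comm h₂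
    exact hA (Subtype.ext (eq_of_mem_of_not_parallel (ray_not_parallel f.zero F) hAr A.2
      (mem_ray_left _ _) f.zero.2))
  have homothety : ∀ (C : f.Pt) (g : L), C ≠ f.zero → C.1 ∈ par Q g →
      (mul F X C).1 ∈ par Q' g := fun C g hC hCQ =>
    desargues_concurrent hcr hrl hcl (left_mem_join hOQ) (mem_ray_left _ _) f.zero.2
      hOQ.symm (pt_ne_aux f.zero F).symm (fun he => hC (Subtype.ext he))
      (ne_of_mem_of_not_mem f.zero.2 hQ'l).symm (pt_ne_aux f.zero R).symm
      (fun he => mul_ne_zero hX hC (Subtype.ext he)) (right_mem_join hOQ) hQc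
      (mem_ray_right _ _) hRF C.2 (mul F X C).2 (mem_par_comm h₁) (mem_par_comm hQR)
      (mem_par_comm (mem_par_ray C F)) (hmul C) hCQ
  have hQA : (mul F X A).1 ∈ par Q' (ray f.zero F) := homothety A _ hA (mem_par_comm h₂)
  have hQS : (mul F X S).1 ∈ par Q' (ray B F) := by
    by_cases hS0 : S = f.zero
    · rw [hS0] at h₃ ⊢
      rw [mul_zero]
      have he : join L f.zero.1 Q hOQ = par Q (ray B F) :=
        eq_of_mem_mem hOQ (left_mem_join _) (right_mem_join _) h₃ (mem_par _ _)
      exact mem_par_of_mem (he ▸ par_parallel Q (ray B F)) hQc (left_mem_join hOQ)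
    · exact homothety S _ hS0 h₃
  refine (add_eq hQR ?_ (mem_par_congr hQS (ray_parallel (hmul B)).symm)).symm
  rw [hR, ray_zero_mulAuxPt]
  exact mem_par_comm hQA

theorem add_mul (E F : f.Aux) (A B X : f.Pt) :
    mul F (add E A B) X = add E (mul F A X) (mul F B X) := by
  by_cases hX : X = f.zero
  · simp only [hX, mul_zero, zero_add]
  by_cases hX1 : X = f.one
  · simp only [hX1, mul_one]
  by_cases hA : A = f.zero
  · simp only [hA, zero_mul, zero_add]
  by_cases hB : B = f.zero
  · simp only [hB, zero_mul, add_zero]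
  rw [add_eq_add E (mulAuxPt F B hB), add_eq_add E (mulAuxPt F B hB)]
  set R := mulAuxPt F B hB with hR
  set S := add R A B with hS
  obtain ⟨T, h₁, h₂, h₃⟩ := add_spec R A B
  obtain ⟨T', h₁', h₂', -⟩ := add_spec R (mul F A X) (mul F B X)
  have hr : ray f.zero R = ray f.zero F := ray_zero_mulAuxPt F B hB
  rw [hr] at h₂ h₂'
  have hAX : (mul F A X).1 ≠ A.1 := by
    intro he
    have h := mul_mem_par F A X
    rw [he] at h
    exact hX1 (eq_of_ray_parallel (parallel_of_mem_par
      (ne_of_mem_of_not_mem A.2 (mulAux_notMem hA)) (mem_par_comm h) (mulAux_mem_par F A)))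
  have hnr : ∀ {C : f.Pt}, ¬ Parallel (par C.1 (ray f.zero F)) f.line :=
    not_parallel_par_left (ray_not_parallel f.zero F)
  have hoff : ∀ {C : f.Pt}, C ≠ f.zero → par C.1 (ray f.zero F) ≠ ray f.zero F := fun hC he =>
    hC (Subtype.ext (eq_of_mem_of_not_parallel (ray_not_parallel f.zero F)
      (he ▸ mem_par _ _) (Subtype.property _) (mem_ray_left _ _) f.zero.2))
  have hMT : T ∈ par (mulAux F S) (ray f.one F) :=
    mem_par_trans (mem_par_comm (mulAux_mem_par F S)) (mem_par_comm (mem_par_congr h₃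
      (ray_parallel (mem_par_comm (mulAux_mem_par F B)))))
  -- The translation along `OF` that takes `A` to `T` takes `mulAux F A` to `mulAux F S` and
  -- `mul F A X` to `T'`.
  have hMT' : T' ∈ par (mulAux F S) (ray X F) :=
    desargues_parallel (hoff hA).symm
      (fun he => hAX (eq_of_mem_of_not_parallel hnr (he ▸ mem_par _ _) (mul F A X).2
        (mem_par A.1 (ray f.zero F)) A.2))
      (hoff (mul_ne_zero hA hX)).symm (par_parallel _ _).symm
      ((par_parallel _ _).trans (par_parallel _ _).symm)
      (mulAux_mem_ray F A) (mulAux_mem_ray F S) (mem_par _ _) h₂ (mem_par _ _) h₂'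
      (mem_par_comm (mulAux_mem_par F A)) hMT
      (mem_par_of_mem (Or.inl rfl) A.2 (mul F A X).2) (mem_par_trans (mem_par_comm h₁) h₁')
      (mul_mem_par F A X)
  refine (add_eq h₁' (hr.symm ▸ h₂') ?_).symm
  exact mem_par_congr (mem_par_trans (mem_par_comm hMT') (mul_mem_par F S X))
    (ray_parallel (mul_mem_par F B X)).symm

/-! ### Natural multiples -/

theorem natMul_succ (E : f.Aux) (n : ℕ) (A : f.Pt) :
    natMul E (n + 1) A = add E (natMul E n A) A := by
  cases n with
  | zero => exact (zero_add E A).symm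
  | succ n => rfl

theorem mul_natMul (E F : f.Aux) (n : ℕ) (X A : f.Pt) :
    mul F X (natMul E n A) = natMul E n (mul F X A) := by
  induction n with
  | zero => exact mul_zero F X
  | succ n ih => rw [natMul_succ, natMul_succ, mul_add, ih]

theorem natMul_mul (E F : f.Aux) (n : ℕ) (A X : f.Pt) :
    mul F (natMul E n A) X = natMul E n (mul F A X) := by
  induction n with
  | zero => exact zero_mul F X
  | succ n ih => rw [natMul_succ, natMul_succ, add_mul, ih]

theorem mul_inv (E : f.Aux) (B : f.Pt) (hB : B ≠ f.zero) : mul E B (inv E B hB) = f.one :=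
  (exists_unique_inv E B hB).choose_spec.1

theorem eq_inv {E : f.Aux} {B X : f.Pt} (hB : B ≠ f.zero) (h : mul E B X = f.one) :
    X = inv E B hB :=
  (exists_unique_inv E B hB).unique h (mul_inv E B hB)

end Desargues

end Frame

end DesarguesPlane

open DesarguesPlane in
theorem mainTheorem12 {P L : Type*} [Membership P L] [DesarguesAffinePlane P L]
    (f : Frame P L) (E F : f.Aux) (n : ℕ) (hn : Frame.natMul E n f.one ≠ f.zero)
    (A B : f.Pt) (hB : B ≠ f.zero) :
    ∃ hnB : Frame.natMul E n B ≠ f.zero,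
      Frame.ratio F (Frame.natMul E n A) (Frame.natMul E n B) hnB = Frame.ratio F A B hB := by
  have hnB : Frame.natMul E n B ≠ f.zero := by
    have h := Frame.mul_ne_zero (E := F) hn hB
    rwa [Frame.natMul_mul, Frame.one_mul] at h
  refine ⟨hnB, ?_⟩
  have h : Frame.natMul E n (Frame.inv F _ hnB) = Frame.inv F B hB :=
    Frame.eq_inv hB (by rw [Frame.mul_natMul, ← Frame.natMul_mul, Frame.mul_inv])
  rw [Frame.ratio, Frame.ratio, Frame.mul_natMul, ← Frame.natMul_mul, h]
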